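/- Setting. An instance consists of $n$ arms with reward distributions supported on $[0,1]$ and means $\theta_1\ge\theta_2\ge\dots\ge\theta_n$. The arms are presented to an algorithm in an unknown order (labelling); each pull of an arm returns an independent reward from its distribution, and a (randomized, adaptive) algorithm decides, from its internal randomness and all rewards observed so far, which arm to pull next or when to stop and which set to output. A set $T$ of $K$ arms is a set of $\epsilon$-top-$K$ arms if $\frac1K\bigl(\sum_{i=1}^K\theta_i-\sum_{i\in T}\theta_i\bigr)\le\epsilon$. Let $\Delta_i=\theta_i-\theta_{K+1}$ for $i\le K$ and $\Delta_i=\theta_K-\theta_i$ for $i>K$; let $t=t(\epsilon,K)$ be the largest $t\in\{0,\dots,K-1\}$ with $\Delta_{K-t}\,t\le K\epsilon$ and $\Delta_{K+t+1}\,t\le K\epsilon$; let $\Psi_t=\min(\Delta_{K-t},\Delta_{K+t+1})$, $\Psi_t^\epsilon=\max(\epsilon,\Psi_t)$, and $H^{(t,\epsilon)}=\sum_{i=1}^n\min\{\Delta_i^{-2},(\Psi_t^\epsilon)^{-2}\}$ (with $0^{-2}=\infty$). Theorem. There are constants $c_1,c_2>0$, and for every $a>0$ there is a constant $c>0$, such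 that the following holds for all integers $K\ge1$, $n=2K$, and all $\epsilon$ with $a/n\le\epsilon\le10^{-4}$. There is an instance on $n$ arms with $c_1n\le H^{(t,\epsilon)}\le c_2n$ such that every algorithm which, for each labelling of the arms of this instance, stops and outputs a set of $\epsilon$-top-$K$ arms with probability at least $0.9$, makes, for at least one labelling, at least $c\,n\ln(1/\epsilon)$ pulls with probability at least $1/2$ (in particular, both its worst-case and its expected number of pulls are $\Omega(n\log\epsilon^{-1})$). -/

import Mathlib

open MeasureTheory ProbabilityTheory
open scoped ENNReal

universe u

/-- An instance of the stochastic bandit with `n` arms: reward distributions supported on `[0,1]`,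
listed in non-increasing order of their means (index `0` is a best arm). The order is not known to
an algorithm, see `BanditInstance.runLaw`. -/
structure BanditInstance (n : ℕ) where
  /-- the reward distribution of each arm -/
  reward : Fin n → Measure ℝ
  isProbability : ∀ i, IsProbabilityMeasure (reward i)
  support_subset : ∀ i, reward i (Set.Icc 0 1)ᶜ = 0
  antitone_mean : Antitone fun i => ∫ x, x ∂(reward i)

attribute [instance] BanditInstance.isProbability

namespace BanditInstance

variable {n : ℕ}

/-- The mean reward of an arm. -/
noncomputable def mean (I : BanditInstance n) (i : Fin n) : ℝ := ∫ x, x ∂(I.reward i)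

/-- The mean `θ_k` of the `k`-th best arm, `1 ≤ k ≤ n` (indices start at `1`, as usual on paper;
the value outside this range is irrelevant). -/
noncomputable def theta (I : BanditInstance n) (k : ℕ) : ℝ :=
  if h : 1 ≤ k ∧ k ≤ n then I.mean ⟨k - 1, by omega⟩ else 0

/-- The gap `Δ_k = Δ_k(K)` of the `k`-th best arm. -/
noncomputable def gap (I : BanditInstance n) (K k : ℕ) : ℝ :=
  if k ≤ K then I.theta k - I.theta (K + 1) else I.theta K - I.theta k

open Classical in
/-- `t(ε, K)`: the largest `t ∈ {0, …, K - 1}` with `Δ_{K-t} t ≤ K ε` and `Δ_{K+t+1} t ≤ K ε`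
(for `ε ≥ 0` the value `t = 0` qualifies). -/
noncomputable def tol (I : BanditInstance n) (K : ℕ) (ε : ℝ) : ℕ :=
  Nat.findGreatest
    (fun t => I.gap K (K - t) * t ≤ K * ε ∧ I.gap K (K + t + 1) * t ≤ K * ε) (K - 1)

/-- `Ψ_t = min (Δ_{K-t}, Δ_{K+t+1})`. -/
noncomputable def Psi (I : BanditInstance n) (K t : ℕ) : ℝ :=
  min (I.gap K (K - t)) (I.gap K (K + t + 1))

/-- `Ψ_t^ε = max (ε, Ψ_t)`. -/
noncomputable def PsiEps (I : BanditInstance n) (K t : ℕ) (ε : ℝ) : ℝ := max ε (I.Psi K t)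

/-- The hardness parameter `H^{(t,ε)} = ∑ k, min (Δ_k⁻², (Ψ_t^ε)⁻²)` with `t = t(ε, K)`, where
`0⁻² = ∞`. -/
noncomputable def hardness (I : BanditInstance n) (K : ℕ) (ε : ℝ) : ℝ :=
  ∑ k ∈ Finset.Icc 1 n,
    if I.gap K k = 0 then (I.PsiEps K (I.tol K ε) ε ^ 2)⁻¹
    else min ((I.gap K k ^ 2)⁻¹) ((I.PsiEps K (I.tol K ε) ε ^ 2)⁻¹)

/-- The aggregate regret of a set `T` of arms. -/
noncomputable def regret (I : BanditInstance n) (K : ℕ) (T : Finset (Fin n)) : ℝ :=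
  (1 / K : ℝ) * (∑ k ∈ Finset.Icc 1 K, I.theta k - ∑ i ∈ T, I.mean i)

/-- `T` is a set of `ε`-top-`K` arms. -/
def IsTopK (I : BanditInstance n) (K : ℕ) (ε : ℝ) (T : Finset (Fin n)) : Prop :=
  T.card = K ∧ I.regret K T ≤ ε

end BanditInstance

/-- A (randomized, adaptive) algorithm for `n` labelled arms. It draws a random seed once; given the
seed and the list of (label, observed reward) pairs of the pulls made so far, it either pulls the
arm with a label `j` (`Sum.inl j`) or stops with a set `T` of labels as its output (`Sum.inr T`). -/
structure BanditAlgorithm (n : ℕ) where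
  /-- the space of random seeds -/
  Seed : Type u
  mSeed : MeasurableSpace Seed
  /-- the distribution of the seed -/
  seedLaw : Measure Seed
  isProbability : IsProbabilityMeasure seedLaw
  /-- the next action, given the seed and the observations so far, oldest first -/
  act : Seed → List (Fin n × ℝ) → Fin n ⊕ Finset (Fin n)
  measurableSet_act : ∀ (t : ℕ) (a : Fin n ⊕ Finset (Fin n)),
    MeasurableSet {p : Seed × (Fin t → Fin n × ℝ) | act p.1 (List.ofFn p.2) = a}

attribute [instance] BanditAlgorithm.mSeed BanditAlgorithm.isProbability

namespace BanditAlgorithm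

variable {n : ℕ}

/-- The observations after `t` rounds, with seed `s`, where `x (j, k)` is the reward of the pull of
label `j` that comes after `k` earlier pulls of `j`. Once the algorithm has stopped, nothing is
pulled any more. -/
def history (A : BanditAlgorithm.{u} n) (s : A.Seed) (x : Fin n × ℕ → ℝ) :
    ℕ → List (Fin n × ℝ)
  | 0 => []
  | t + 1 =>
    match A.act s (A.history s x t) with
    | Sum.inl j =>
        A.history s x t ++ [(j, x (j, (A.history s x t).countP fun q => q.1 = j))]
    | Sum.inr _ => A.history s x t

/-- The total number of pulls (`⊤` if the algorithm never stops). -/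
noncomputable def pulls (A : BanditAlgorithm.{u} n) (s : A.Seed) (x : Fin n × ℕ → ℝ) : ℕ∞ :=
  ⨆ t, ((A.history s x t).length : ℕ∞)

/-- The algorithm stops and its output is `T`. -/
def Outputs (A : BanditAlgorithm.{u} n) (s : A.Seed) (x : Fin n × ℕ → ℝ)
    (T : Finset (Fin n)) : Prop :=
  ∃ t, A.act s (A.history s x t) = Sum.inr T

end BanditAlgorithm

namespace BanditInstance

variable {n : ℕ}

/-- The joint law of the seed and of all rewards when the algorithm `A` is run on the instance `I`
whose arms are presented under the labelling `σ`: label `j` stands for the arm `σ j`. The rewards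
are independent, those of label `j` have the distribution of the arm `σ j`, and they are
independent of the seed. -/
noncomputable def runLaw (I : BanditInstance n) (σ : Equiv.Perm (Fin n))
    (A : BanditAlgorithm.{u} n) : Measure (A.Seed × (Fin n × ℕ → ℝ)) :=
  A.seedLaw.prod (Measure.infinitePi fun p : Fin n × ℕ => I.reward (σ p.1))

/-- The probability that `A`, run on `I` under the labelling `σ`, stops and outputs the labels of a
set of `ε`-top-`K` arms. -/
noncomputable def successProb (I : BanditInstance n) (σ : Equiv.Perm (Fin n)) (K : ℕ) (ε : ℝ)
    (A : BanditAlgorithm.{u} n) : ℝ :=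
  (I.runLaw σ A).real
    {p | ∃ T, A.Outputs p.1 p.2 T ∧ I.IsTopK K ε (T.map σ.toEmbedding)}

/-- The probability that `A`, run on `I` under the labelling `σ`, makes at least `B` pulls. -/
noncomputable def manyPullsProb (I : BanditInstance n) (σ : Equiv.Perm (Fin n)) (B : ℝ)
    (A : BanditAlgorithm.{u} n) : ℝ :=
  (I.runLaw σ A).real {p | ENNReal.ofReal B ≤ (A.pulls p.1 p.2 : ℝ≥0∞)}

end BanditInstance

/-! The hard instance has `K` arms that are coins of bias `3/4` (good) and `K` of bias `1/4` (bad).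
All gaps are `1/2`, so the hardness is exactly `4n`, and an output `T` of size `K` succeeds iff it
contains at most `m = ⌊nε⌋` bad labels.

Fix a transcript with fewer than `c n log(1/ε)` pulls and an output `T`, and weigh each labelling by
the likelihood of the transcript. With `N = ⌊8c log(1/ε)⌋`, fewer than `K/4` labels are heavy, that
is, pulled more than `N` times. One reward changes the likelihood by a factor of at most `3`, so
exchanging two light labels costs at most `q²` with `q = 3 ^ N ≤ ε^(-1/2)` (if `N = 0`, `q = 1`).
Let `W j` be the total weight of the labellings with `j` bad labels in `T`. Exchanging a good light
label of `T` with a bad light label outside leads from level `j` to level `j + 1`. There are at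
least `(q(j+1))²` such exchanges at each labelling of level `j`, and at most `(j+1)²` arrive at each
labelling of level `j + 1`; hence `W j ≤ W (j+1)` for `j ≤ 2m` (`levelWeight_le_succ`). So levels
`0, …, m` weigh no more than levels `m+1, …, 2m+1`: given a short transcript and a uniformly random
labelling, failure is at least as likely as success (`sum_success_le_sum_failure`).

Summing over transcripts (`exists_manyPulls`), short successful runs are on average no more likely
than short failing ones, which have probability at most `1/10`. Short runs thus have average
probability at most `1/5`, so for some labelling long runs have probability at least `1/2`. -/

/-! ### Transcripts, their cylinders, and measurability of runs -/

namespace BanditAlgorithm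

variable {n : ℕ}

/-- The rewards of label `j` recorded in the transcript `h`, oldest first. -/
def rewardsOf (h : List (Fin n × ℝ)) (j : Fin n) : List ℝ :=
  (h.filter fun q => q.1 = j).map Prod.snd

theorem length_rewardsOf (h : List (Fin n × ℝ)) (j : Fin n) :
    (rewardsOf h j).length = h.countP fun q => q.1 = j := by
  simp [rewardsOf, List.countP_eq_length_filter]

theorem rewardsOf_append_singleton (h : List (Fin n × ℝ)) (i j : Fin n) (y : ℝ) :
    rewardsOf (h ++ [(i, y)]) j = rewardsOf h j ++ if i = j then [y] else [] := by
  by_cases hij : i = j <;> simp [rewardsOf, hij]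

theorem sum_length_rewardsOf (h : List (Fin n × ℝ)) :
    ∑ j, (rewardsOf h j).length = h.length := by
  induction h using List.reverseRecOn with
  | nil => simp [rewardsOf]
  | append_singleton h q ih =>
    obtain ⟨i, y⟩ := q
    simp only [rewardsOf_append_singleton, List.length_append, Finset.sum_add_distrib, ih]
    congr 1
    rw [Finset.sum_eq_single i] <;> simp +contextual [eq_comm]

theorem length_rewardsOf_le (h : List (Fin n × ℝ)) (j : Fin n) :
    (rewardsOf h j).length ≤ h.length := by
  rw [length_rewardsOf]
  exact List.countP_le_length

/-- The values of the reward in the cell `p` that are compatible with the transcript `h`. -/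
def compatible (h : List (Fin n × ℝ)) (p : Fin n × ℕ) : Set ℝ :=
  {y | ∀ z ∈ (rewardsOf h p.1)[p.2]?, y = z}

/-- The reward tables that agree with the transcript `h`. -/
def cylinder (h : List (Fin n × ℝ)) : Set (Fin n × ℕ → ℝ) :=
  {x | ∀ p, x p ∈ compatible h p}

theorem compatible_eq_univ {h : List (Fin n × ℝ)} {p : Fin n × ℕ}
    (hp : (rewardsOf h p.1).length ≤ p.2) : compatible h p = Set.univ := by
  simp [compatible, List.getElem?_eq_none hp]

theorem measurableSet_compatible (h : List (Fin n × ℝ)) (p : Fin n × ℕ) :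
    MeasurableSet (compatible h p) := by
  unfold compatible
  cases (rewardsOf h p.1)[p.2]? <;> simp

/-- A transcript constrains only finitely many cells, so its cylinder is a finite box, whose product
measure is a finite product. -/
theorem cylinder_eq_pi (h : List (Fin n × ℝ)) :
    cylinder h = Set.pi ↑((Finset.univ : Finset (Fin n)) ×ˢ Finset.range h.length)
      (compatible h) := by
  ext x
  simp only [cylinder, Set.mem_ofPred_eq, Set.mem_pi, Finset.coe_product, Set.mem_prod,
    Finset.coe_univ, Set.mem_univ, true_and, Finset.coe_range, Set.mem_Iio]
  refine ⟨fun hx p _ => hx p, fun hx p => ?_⟩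
  by_cases hp : p.2 < h.length
  · exact hx p hp
  · rw [compatible_eq_univ ((length_rewardsOf_le h p.1).trans (not_lt.1 hp))]
    trivial

theorem measurableSet_cylinder (h : List (Fin n × ℝ)) : MeasurableSet (cylinder h) := by
  rw [cylinder_eq_pi]
  exact MeasurableSet.pi (Finset.countable_toSet _) fun p _ => measurableSet_compatible h p

theorem mem_cylinder_append {h : List (Fin n × ℝ)} {x : Fin n × ℕ → ℝ} {j : Fin n} {y : ℝ} :
    x ∈ cylinder (h ++ [(j, y)]) ↔
      x ∈ cylinder h ∧ x (j, h.countP fun q => q.1 = j) = y := by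
  simp only [cylinder, compatible, Set.mem_ofPred_eq, rewardsOf_append_singleton, Prod.forall]
  rw [← length_rewardsOf]
  constructor
  · intro H
    refine ⟨fun i k z hz => H i k z ?_, H _ _ y ?_⟩
    · rw [Option.mem_def] at hz ⊢
      rw [List.getElem?_append_left (List.getElem?_eq_some_iff.1 hz).1, hz]
    · simp
  · rintro ⟨H, hy⟩ i k z hz
    rw [Option.mem_def] at hz
    rcases lt_or_ge k (rewardsOf h i).length with hk | hk
    · rw [List.getElem?_append_left hk] at hz
      exact H i k z hz
    · rw [List.getElem?_append_right hk] at hz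
      split_ifs at hz with hij
      · subst hij
        obtain ⟨h1, h2⟩ := List.getElem?_eq_some_iff.1 hz
        have : k = (rewardsOf h j).length := by simp at h1; omega
        subst this
        simpa [hy] using h2
      · simp at hz

theorem exists_mem_cylinder (h : List (Fin n × ℝ)) : ∃ x, x ∈ cylinder h := by
  refine ⟨fun p => ((rewardsOf h p.1)[p.2]?).getD 0, fun p z hz => ?_⟩
  rw [Option.mem_def] at hz
  simp [hz]

variable (A : BanditAlgorithm.{u} n) {s : A.Seed} {x : Fin n × ℕ → ℝ}

theorem history_succ_of_inl {t : ℕ} {j : Fin n} (h : A.act s (A.history s x t) = Sum.inl j) :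
    A.history s x (t + 1) =
      A.history s x t ++ [(j, x (j, (A.history s x t).countP fun q => q.1 = j))] := by
  simp [history, h]

theorem history_succ_of_inr {t : ℕ} {T : Finset (Fin n)}
    (h : A.act s (A.history s x t) = Sum.inr T) : A.history s x (t + 1) = A.history s x t := by
  simp [history, h]

theorem mem_cylinder_history (t : ℕ) : x ∈ cylinder (A.history s x t) := by
  induction t with
  | zero => simp [history, cylinder, compatible, rewardsOf]
  | succ t ih =>
    rcases h : A.act s (A.history s x t) with j | T
    · rw [A.history_succ_of_inl h, mem_cylinder_append]
      exact ⟨ih, rfl⟩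
    · rwa [A.history_succ_of_inr h]

/-- A run reads only the cells recorded in its transcript, so a table agreeing there drives the
algorithm identically. -/
theorem history_eq_of_mem_cylinder {y : Fin n × ℕ → ℝ} {t : ℕ}
    (hy : y ∈ cylinder (A.history s x t)) : A.history s y t = A.history s x t := by
  induction t with
  | zero => rfl
  | succ t ih =>
    rcases h : A.act s (A.history s x t) with j | T
    · rw [A.history_succ_of_inl h, mem_cylinder_append] at hy
      have e := ih hy.1
      rw [A.history_succ_of_inl h, A.history_succ_of_inl (e ▸ h), e, hy.2]
    · rw [A.history_succ_of_inr h] at hy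
      have e := ih hy
      rw [A.history_succ_of_inr h, A.history_succ_of_inr (e ▸ h), e]

theorem history_add_of_inr {t : ℕ} {T : Finset (Fin n)}
    (h : A.act s (A.history s x t) = Sum.inr T) (d : ℕ) :
    A.history s x (t + d) = A.history s x t := by
  induction d with
  | zero => rfl
  | succ d ih => rw [← add_assoc, A.history_succ_of_inr (T := T) (by rw [ih, h]), ih]

theorem output_unique {t t' : ℕ} {T T' : Finset (Fin n)}
    (h : A.act s (A.history s x t) = Sum.inr T)
    (h' : A.act s (A.history s x t') = Sum.inr T') : T = T' := by
  rcases le_total t t' with ht | ht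
  · obtain ⟨d, rfl⟩ := Nat.exists_eq_add_of_le ht
    rw [A.history_add_of_inr h, h] at h'
    exact Sum.inr.inj h'
  · obtain ⟨d, rfl⟩ := Nat.exists_eq_add_of_le ht
    rw [A.history_add_of_inr h', h'] at h
    exact (Sum.inr.inj h).symm

theorem length_history_of_inl {t : ℕ} {j : Fin n}
    (h : A.act s (A.history s x t) = Sum.inl j) : (A.history s x t).length = t := by
  induction t generalizing j with
  | zero => rfl
  | succ t ih =>
    rcases h' : A.act s (A.history s x t) with i | T
    · rw [A.history_succ_of_inl h', List.length_append, ih h']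
      rfl
    · rw [A.history_succ_of_inr h', h'] at h
      cases h

theorem length_history_le_pulls (t : ℕ) :
    ((A.history s x t).length : ℕ∞) ≤ A.pulls s x :=
  le_iSup (fun t => ((A.history s x t).length : ℕ∞)) t

theorem snd_mem_of_mem_history {V : Set ℝ} (hx : ∀ p, x p ∈ V) (t : ℕ) :
    ∀ q ∈ A.history s x t, q.2 ∈ V := by
  induction t with
  | zero => simp [history]
  | succ t ih =>
    rcases h : A.act s (A.history s x t) with j | T
    · rw [A.history_succ_of_inl h]
      intro q hq
      rcases List.mem_append.1 hq with hq | hq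
      · exact ih q hq
      · rw [List.mem_singleton.1 hq]
        exact hx _
    · rwa [A.history_succ_of_inr h]

theorem measurableSet_act_eq (h : List (Fin n × ℝ)) (a : Fin n ⊕ Finset (Fin n)) :
    MeasurableSet {s | A.act s h = a} := by
  have hm : Measurable fun s : A.Seed => (s, h.get) := measurable_id.prodMk measurable_const
  have := hm (A.measurableSet_act h.length a)
  simpa only [Set.preimage_ofPred_eq, List.ofFn_get] using this

theorem measurableSet_history_eq (x : Fin n × ℕ → ℝ) (t : ℕ) (h : List (Fin n × ℝ)) :
    MeasurableSet {s | A.history s x t = h} := by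
  induction t generalizing h with
  | zero => simp [history]
  | succ t ih =>
    -- Either the last round appended the final entry of `h`, or the algorithm had already stopped
    -- with transcript `h`.
    have e : {s | A.history s x (t + 1) = h} =
        (⋃ j : Fin n, {s | A.history s x t = h.dropLast} ∩
          ({s | A.act s h.dropLast = Sum.inl j} ∩
          {_s | h.dropLast ++ [(j, x (j, h.dropLast.countP fun q => q.1 = j))] = h})) ∪
        ⋃ T : Finset (Fin n), {s | A.history s x t = h} ∩ {s | A.act s h = Sum.inr T} := by
      ext s
      simp only [Set.mem_ofPred_eq, Set.mem_union, Set.mem_iUnion, Set.mem_inter_iff]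
      constructor
      · intro hs
        rcases h' : A.act s (A.history s x t) with j | T
        · rw [A.history_succ_of_inl h'] at hs
          have hd : A.history s x t = h.dropLast := by rw [← hs, List.dropLast_concat]
          exact Or.inl ⟨j, hd, hd ▸ h', hd ▸ hs⟩
        · rw [A.history_succ_of_inr h'] at hs
          exact Or.inr ⟨T, hs, hs ▸ h'⟩
      · rintro (⟨j, h1, h2, h3⟩ | ⟨T, h1, h2⟩)
        · rw [A.history_succ_of_inl (h1 ▸ h2), h1, h3]
        · rw [A.history_succ_of_inr (h1 ▸ h2), h1]
    rw [e]
    refine .union (.iUnion fun j => ?_) (.iUnion fun T => ?_)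
    · exact (ih _).inter ((A.measurableSet_act_eq _ _).inter (.const _))
    · exact (ih _).inter (A.measurableSet_act_eq _ _)

/-- The runs whose transcript after `t` rounds is `h`, and which have then stopped with output
`T`. -/
def runsTo (t : ℕ) (h : List (Fin n × ℝ)) (T : Finset (Fin n)) :
    Set (A.Seed × (Fin n × ℕ → ℝ)) :=
  {p | A.history p.1 p.2 t = h ∧ A.act p.1 h = Sum.inr T}

/-- The seeds with which some run produces the transcript `h` after `t` rounds and has then stopped
with output `T`. -/
def seedsTo (t : ℕ) (h : List (Fin n × ℝ)) (T : Finset (Fin n)) : Set A.Seed :=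
  {s | (∃ x, A.history s x t = h) ∧ A.act s h = Sum.inr T}

/-- This separates seed from rewards: only the cylinder factor has a probability that depends on the
labelling. -/
theorem runsTo_eq_prod (t : ℕ) (h : List (Fin n × ℝ)) (T : Finset (Fin n)) :
    A.runsTo t h T = A.seedsTo t h T ×ˢ cylinder h := by
  ext ⟨s, x⟩
  constructor
  · rintro ⟨h1, h2⟩
    refine ⟨⟨⟨x, h1⟩, h2⟩, ?_⟩
    dsimp only at h1 ⊢
    rw [← h1]
    exact A.mem_cylinder_history t
  · rintro ⟨⟨⟨y, h1⟩, h2⟩, h3⟩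
    dsimp only at h1 h2 h3
    exact ⟨by rw [← h1] at h3 ⊢; exact A.history_eq_of_mem_cylinder h3, h2⟩

/-- The existential over tables is harmless: any one fixed table in the cylinder of `h` serves as
witness for all seeds. -/
theorem measurableSet_seedsTo (t : ℕ) (h : List (Fin n × ℝ)) (T : Finset (Fin n)) :
    MeasurableSet (A.seedsTo t h T) := by
  obtain ⟨y, hy⟩ := exists_mem_cylinder h
  have e : A.seedsTo t h T = {s | A.history s y t = h} ∩ {s | A.act s h = Sum.inr T} := by
    ext s
    refine and_congr_left fun _ => ⟨?_, fun h1 => ⟨y, h1⟩⟩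
    rintro ⟨x, h1⟩
    rw [← h1] at hy ⊢
    exact A.history_eq_of_mem_cylinder hy
  rw [e]
  exact (A.measurableSet_history_eq _ _ _).inter (A.measurableSet_act_eq _ _)

theorem measurableSet_runsTo (t : ℕ) (h : List (Fin n × ℝ)) (T : Finset (Fin n)) :
    MeasurableSet (A.runsTo t h T) := by
  rw [runsTo_eq_prod]
  exact (A.measurableSet_seedsTo t h T).prod (measurableSet_cylinder h)

end BanditAlgorithm

/-! ### Double counting of labellings by exchanges of labels -/

open Finset in
/-- The number of labels in `T` that stand for a bad arm (one of index at least `K`). -/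
def badCount {n : ℕ} (K : ℕ) (T : Finset (Fin n)) (σ : Equiv.Perm (Fin n)) : ℕ :=
  (T.filter fun i => K ≤ (σ i : ℕ)).card

section Combinatorics
open Finset

variable {K : ℕ}

theorem card_bad (n K : ℕ) (h : n = 2 * K) (σ : Equiv.Perm (Fin n)) :
    (univ.filter fun i => K ≤ (σ i : ℕ)).card = K := by
  subst h
  have e : (univ.filter fun i : Fin (2 * K) => K ≤ (σ i : ℕ)).map σ.toEmbedding
      = univ.filter fun i : Fin (2 * K) => K ≤ (i : ℕ) := by
    ext i
    simp only [mem_map, mem_filter, mem_univ, true_and, Equiv.coe_toEmbedding]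
    exact ⟨by rintro ⟨j, h, rfl⟩; exact h, fun h => ⟨σ.symm i, by simpa using h, by simp⟩⟩
  rw [← card_map σ.toEmbedding, e]
  have := Fin.card_filter_val_lt (n := 2 * K) (m := K)
  have h2 := card_filter_add_card_filter_not (s := (univ : Finset (Fin (2 * K))))
    (fun i => (i : ℕ) < K)
  simp only [not_lt, card_univ, Fintype.card_fin] at h2
  omega

/-- `T` and the set of bad labels both have `K` elements, so each bad label inside `T` is balanced
by a good one outside. -/
theorem card_compl_bad {n : ℕ} (h : n = 2 * K) {T : Finset (Fin n)} (hT : T.card = K)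
    (σ : Equiv.Perm (Fin n)) :
    ((Tᶜ).filter fun i => ¬ K ≤ (σ i : ℕ)).card = badCount K T σ := by
  have h1 := card_bad n K h σ
  have h2 := card_filter_add_card_filter_not (s := Tᶜ) (fun i => K ≤ (σ i : ℕ))
  have h3 : (univ.filter fun i => K ≤ (σ i : ℕ)).card =
      badCount K T σ + ((Tᶜ).filter fun i => K ≤ (σ i : ℕ)).card := by
    rw [badCount, ← card_union_of_disjoint, ← filter_union, union_compl]
    exact disjoint_filter_filter disjoint_compl_right
  rw [card_compl, Fintype.card_fin] at h2
  omega

/-- Swapping a good label inside `T` with a bad label outside `T` raises the number of bad labels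
in `T` by one. -/
theorem badCount_mul_swap {n : ℕ} {T : Finset (Fin n)} {σ : Equiv.Perm (Fin n)} {g b : Fin n}
    (hg : g ∈ T) (hb : b ∉ T) (hσg : ¬ K ≤ (σ g : ℕ)) (hσb : K ≤ (σ b : ℕ)) :
    badCount K T (σ * Equiv.swap g b) = badCount K T σ + 1 := by
  have e : (T.filter fun i => K ≤ ((σ * Equiv.swap g b) i : ℕ)) =
      insert g (T.filter fun i => K ≤ (σ i : ℕ)) := by
    ext i
    simp only [mem_filter, mem_insert]
    rw [Equiv.Perm.mul_apply]
    by_cases hi : i = g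
    · subst hi; simp [hg, hσb]
    · by_cases hib : i = b
      · subst hib; simp [hb, hi]
      · rw [Equiv.swap_apply_of_ne_of_ne hi hib]; simp [hi]
  rw [badCount, e, card_insert_of_notMem (by simp [hσg]), badCount]

/-- The total weight of the labellings with `j` bad labels in `T`. -/
noncomputable def levelWeight {n : ℕ} (K : ℕ) (T : Finset (Fin n)) (w : Equiv.Perm (Fin n) → ℝ≥0∞)
    (j : ℕ) : ℝ≥0∞ :=
  ∑ σ with badCount K T σ = j, w σ

/-- If the labels outside `H` can be swapped at a cost of at most a factor `q ^ 2`, then levels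
with few bad labels weigh no more than the next level. -/
theorem levelWeight_le_succ {n : ℕ} (hn : n = 2 * K) {T H : Finset (Fin n)} (hT : T.card = K)
    {w : Equiv.Perm (Fin n) → ℝ≥0∞} {q : ℕ}
    (hw : ∀ σ, ∀ g ∉ H, ∀ b ∉ H, w σ ≤ (q : ℝ≥0∞) ^ 2 * w (σ * Equiv.swap g b))
    {j : ℕ} (hj : q * (j + 1) + j + H.card ≤ K) (hq : 0 < q) :
    levelWeight K T w j ≤ levelWeight K T w (j + 1) := by
  -- `S σ` holds the exchanges leading up from `σ` that avoid `H`; `S'` contains all exchanges by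
  -- which a labelling can be reached from the level below.
  set S : Equiv.Perm (Fin n) → Finset (Fin n × Fin n) := fun σ =>
    (T.filter fun i => ¬ K ≤ (σ i : ℕ) ∧ i ∉ H) ×ˢ ((Tᶜ).filter fun i => K ≤ (σ i : ℕ) ∧ i ∉ H)
    with hS
  set S' : Equiv.Perm (Fin n) → Finset (Fin n × Fin n) := fun σ =>
    (T.filter fun i => K ≤ (σ i : ℕ)) ×ˢ ((Tᶜ).filter fun i => ¬ K ≤ (σ i : ℕ)) with hS'
  have hTc : (Tᶜ).card = K := by rw [card_compl, Fintype.card_fin]; omega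
  have hScard : ∀ σ, badCount K T σ = j → (q * (j + 1)) ^ 2 ≤ (S σ).card := by
    intro σ hσ
    rw [hS, card_product, sq]
    have key : ∀ (U : Finset (Fin n)) (P : Fin n → Prop) [DecidablePred P], U.card = K →
        (U.filter fun i => ¬ P i).card = j → q * (j + 1) ≤ (U.filter fun i => P i ∧ i ∉ H).card := by
      intro U P _ hU hP
      have h1 := card_filter_add_card_filter_not (s := U) P
      have h2 : (U.filter P).card ≤ (U.filter fun i => P i ∧ i ∉ H).card + H.card := by
        refine (card_le_card ?_).trans (card_union_le _ _)
        intro i hi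
        by_cases hH : i ∈ H <;> simp_all
      omega
    refine Nat.mul_le_mul (key _ _ hT ?_) (key _ _ hTc ?_)
    · simpa [badCount] using hσ
    · rw [card_compl_bad hn hT, hσ]
  have hS'card : ∀ σ, badCount K T σ = j + 1 → (S' σ).card = (j + 1) ^ 2 := by
    intro σ hσ
    rw [hS', card_product, card_compl_bad hn hT, hσ, sq]
    rw [show (T.filter fun i => K ≤ (σ i : ℕ)).card = j + 1 from hσ]
  have main : ((q * (j + 1) : ℕ) : ℝ≥0∞) ^ 2 * levelWeight K T w j ≤
      ((q * (j + 1) : ℕ) : ℝ≥0∞) ^ 2 * levelWeight K T w (j + 1) := by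
    calc ((q * (j + 1) : ℕ) : ℝ≥0∞) ^ 2 * levelWeight K T w j
        = ∑ σ with badCount K T σ = j, (((q * (j + 1)) ^ 2 : ℕ) : ℝ≥0∞) * w σ := by
          rw [levelWeight, mul_sum]; push_cast; rfl
      _ ≤ ∑ σ with badCount K T σ = j, ((S σ).card : ℝ≥0∞) * w σ := by
          refine sum_le_sum fun σ hσ => ?_
          gcongr
          exact hScard σ (mem_filter.1 hσ).2
      _ = ∑ σ with badCount K T σ = j, ∑ p ∈ S σ, w σ := by
          simp only [sum_const, nsmul_eq_mul]
      _ ≤ ∑ σ with badCount K T σ = j, ∑ p ∈ S σ,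
            (q : ℝ≥0∞) ^ 2 * w (σ * Equiv.swap p.1 p.2) := by
          refine sum_le_sum fun σ _ => sum_le_sum fun p hp => ?_
          simp only [hS, mem_product, mem_filter] at hp
          exact hw σ _ hp.1.2.2 _ hp.2.2.2
      _ = ∑ x ∈ (univ.filter fun σ => badCount K T σ = j).sigma S,
            (q : ℝ≥0∞) ^ 2 * w (x.1 * Equiv.swap x.2.1 x.2.2) := by
          rw [sum_sigma]
      _ ≤ ∑ x ∈ (univ.filter fun σ => badCount K T σ = j + 1).sigma S',
            (q : ℝ≥0∞) ^ 2 * w x.1 := by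
          -- Keeping the exchanged pair makes the map injective: the old labelling is recovered by
          -- undoing the swap.
          let f : (Σ _ : Equiv.Perm (Fin n), Fin n × Fin n) →
              (Σ _ : Equiv.Perm (Fin n), Fin n × Fin n) :=
            fun x => ⟨x.1 * Equiv.swap x.2.1 x.2.2, x.2⟩
          have hf : Function.Injective f := by
            rintro ⟨σ, p⟩ ⟨τ, r⟩ h
            simp only [f, Sigma.mk.injEq, heq_eq_eq] at h
            obtain ⟨h1, rfl⟩ := h
            rw [mul_left_inj] at h1
            rw [h1]
          rw [← sum_image (s := (univ.filter fun σ => badCount K T σ = j).sigma S) (g := f)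
            (f := fun x => (q : ℝ≥0∞) ^ 2 * w x.1) hf.injOn]
          refine sum_le_sum_of_subset fun y hy => ?_
          obtain ⟨⟨σ, g, b⟩, hx, rfl⟩ := mem_image.1 hy
          simp only [mem_sigma, mem_filter, mem_univ, true_and, hS, mem_product, mem_compl] at hx
          obtain ⟨hσ, ⟨hg, hσg, -⟩, hb, hσb, -⟩ := hx
          simp only [f, mem_sigma, mem_filter, mem_univ, true_and, hS', mem_product, mem_compl]
          simp only [Equiv.Perm.mul_apply, Equiv.swap_apply_left, Equiv.swap_apply_right]
          exact ⟨by rw [badCount_mul_swap hg hb hσg hσb, hσ], ⟨hg, hσb⟩, hb, hσg⟩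
      _ = ((q * (j + 1) : ℕ) : ℝ≥0∞) ^ 2 * levelWeight K T w (j + 1) := by
          rw [sum_sigma, levelWeight, mul_sum]
          refine sum_congr rfl fun σ hσ => ?_
          dsimp only
          rw [sum_const, hS'card σ (mem_filter.1 hσ).2, nsmul_eq_mul]
          push_cast
          ring
  rwa [ENNReal.mul_le_mul_iff_right (by positivity)
    (ENNReal.pow_ne_top (ENNReal.natCast_ne_top _))] at main

/-- Under the swap condition, the labellings with at most `m` bad labels in `T` weigh no more than
the other ones. -/
theorem sum_success_le_sum_failure {n : ℕ} (hn : n = 2 * K) {T H : Finset (Fin n)}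
    (hT : T.card = K) {w : Equiv.Perm (Fin n) → ℝ≥0∞} {q : ℕ}
    (hw : ∀ σ, ∀ g ∉ H, ∀ b ∉ H, w σ ≤ (q : ℝ≥0∞) ^ 2 * w (σ * Equiv.swap g b))
    {m : ℕ} (hm : q * (2 * m + 1) + 2 * m + H.card ≤ K) (hq : 0 < q) :
    ∑ σ with badCount K T σ ≤ m, w σ ≤ ∑ σ with ¬ badCount K T σ ≤ m, w σ := by
  -- The last step goes from level `2m` to `2m + 1`, which is exactly what `hm` allows.
  have mono : ∀ d j, j + d ≤ 2 * m + 1 → levelWeight K T w j ≤ levelWeight K T w (j + d) := by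
    intro d
    induction d with
    | zero => intro j _; rfl
    | succ d ih =>
      intro j hjd
      refine (ih j (by omega)).trans ?_
      rw [← add_assoc]
      refine levelWeight_le_succ hn hT hw ?_ hq
      have : q * (j + d + 1) ≤ q * (2 * m + 1) := Nat.mul_le_mul_left _ (by omega)
      omega
  have fiber : ∀ (s : Finset ℕ), ∑ σ with badCount K T σ ∈ s, w σ =
      ∑ j ∈ s, levelWeight K T w j := by
    intro s
    rw [← sum_fiberwise_of_maps_to (s := univ.filter fun σ => badCount K T σ ∈ s) (t := s)
      (g := badCount K T) (by simp)]
    refine sum_congr rfl fun j hj => ?_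
    rw [levelWeight, filter_filter]
    congr 1
    ext σ
    simp only [mem_filter, mem_univ, true_and, and_iff_right_iff_imp]
    rintro rfl
    exact hj
  calc ∑ σ with badCount K T σ ≤ m, w σ
      = ∑ j ∈ range (m + 1), levelWeight K T w j := by
        rw [← fiber]; simp only [mem_range, Nat.lt_succ_iff]
    _ ≤ ∑ j ∈ range (m + 1), levelWeight K T w (j + (m + 1)) := by
        refine sum_le_sum fun j hj => mono _ _ ?_
        rw [mem_range] at hj
        omega
    _ = ∑ j ∈ (range (m + 1)).map (addRightEmbedding (m + 1)), levelWeight K T w j := by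
        rw [sum_map]; rfl
    _ = ∑ σ with badCount K T σ ∈ (range (m + 1)).map (addRightEmbedding (m + 1)), w σ := by
        rw [fiber]
    _ ≤ ∑ σ with ¬ badCount K T σ ≤ m, w σ := by
        refine sum_le_sum_of_subset fun σ hσ => ?_
        simp only [mem_filter, mem_univ, true_and, mem_map, addRightEmbedding_apply] at hσ ⊢
        obtain ⟨j, -, h⟩ := hσ
        omega

end Combinatorics

/-! ### The two-level instance -/

/-- The law of a reward that is `1` with probability `p` and `0` with probability `q`. -/
noncomputable def coinLaw (p q : ℝ≥0∞) : Measure ℝ :=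
  p • Measure.dirac 1 + q • Measure.dirac 0

theorem coinLaw_apply_le {p q p' q' c : ℝ≥0∞} (hp : p ≤ c * p') (hq : q ≤ c * q') (S : Set ℝ) :
    coinLaw p q S ≤ c * coinLaw p' q' S := by
  simp only [coinLaw, Measure.add_apply, Measure.smul_apply, smul_eq_mul, mul_add, ← mul_assoc]
  gcongr

theorem integral_id_coinLaw {p q : ℝ≥0∞} (hp : p ≠ ∞) (hq : q ≠ ∞) :
    ∫ x, x ∂(coinLaw p q) = p.toReal := by
  have hi : ∀ y : ℝ, Integrable (fun x : ℝ => x) (Measure.dirac y) := fun y =>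
    integrable_dirac (by simp)
  rw [coinLaw, integral_add_measure ((hi 1).smul_measure hp) ((hi 0).smul_measure hq)]
  simp

/-- The reward law of the arm of index `i`: mean `3 / 4` for `i < K`, mean `1 / 4` otherwise. -/
noncomputable def twoLevelLaw (K i : ℕ) : Measure ℝ :=
  if K ≤ i then coinLaw (1 / 4) (3 / 4) else coinLaw (3 / 4) (1 / 4)

theorem quarter_le_three_mul : (1 / 4 : ℝ≥0∞) ≤ 3 * (1 / 4) := by
  conv_lhs => rw [← one_mul (1 / 4 : ℝ≥0∞)]
  gcongr
  norm_num

theorem three_quarters_eq : (3 / 4 : ℝ≥0∞) = 3 * (1 / 4) := by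
  rw [mul_one_div]

theorem quarter_le_three_quarters : (1 / 4 : ℝ≥0∞) ≤ 3 / 4 := by
  rw [three_quarters_eq]
  exact quarter_le_three_mul

theorem le_three_mul_self (x : ℝ≥0∞) : x ≤ 3 * x := by
  conv_lhs => rw [← one_mul x]
  gcongr
  norm_num

theorem twoLevelLaw_apply_le (K i j : ℕ) (S : Set ℝ) :
    twoLevelLaw K i S ≤ 3 * twoLevelLaw K j S := by
  unfold twoLevelLaw
  have h1 : (1 / 4 : ℝ≥0∞) ≤ 3 * (3 / 4) :=
    quarter_le_three_quarters.trans (le_three_mul_self _)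
  split_ifs
  · exact le_three_mul_self _
  · exact coinLaw_apply_le h1 three_quarters_eq.le S
  · exact coinLaw_apply_le three_quarters_eq.le h1 S
  · exact le_three_mul_self _

theorem three_quarters_add_quarter : (3 / 4 : ℝ≥0∞) + 1 / 4 = 1 := by
  rw [← ENNReal.add_div, show (3 : ℝ≥0∞) + 1 = 4 by norm_num]
  exact ENNReal.div_self (by norm_num) (by norm_num)

instance (K i : ℕ) : IsProbabilityMeasure (twoLevelLaw K i) := by
  constructor
  unfold twoLevelLaw coinLaw
  split_ifs
  · simpa [add_comm] using three_quarters_add_quarter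
  · simpa using three_quarters_add_quarter

theorem twoLevelLaw_compl_zero_one (K i : ℕ) : twoLevelLaw K i ({0, 1} : Set ℝ)ᶜ = 0 := by
  unfold twoLevelLaw coinLaw
  split_ifs <;> simp

theorem integral_id_twoLevelLaw (K i : ℕ) :
    ∫ x, x ∂(twoLevelLaw K i) = if K ≤ i then 1 / 4 else 3 / 4 := by
  unfold twoLevelLaw
  split_ifs
  · rw [integral_id_coinLaw (ENNReal.div_ne_top (by norm_num) (by norm_num))
      (ENNReal.div_ne_top (by norm_num) (by norm_num))]
    simp
  · rw [integral_id_coinLaw (ENNReal.div_ne_top (by norm_num) (by norm_num))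
      (ENNReal.div_ne_top (by norm_num) (by norm_num))]
    simp

/-- The instance with `K` arms of mean `3 / 4` and `n - K` arms of mean `1 / 4`. -/
noncomputable def twoLevel (n K : ℕ) : BanditInstance n where
  reward i := twoLevelLaw K i
  isProbability _ := inferInstance
  support_subset i := by
    refine measure_mono_null (Set.compl_subset_compl.2 ?_) (twoLevelLaw_compl_zero_one K i)
    rintro x (rfl | rfl) <;> simp
  antitone_mean i j hij := by
    have hij' : (i : ℕ) ≤ j := hij
    simp only [integral_id_twoLevelLaw]
    split_ifs with h1 h2 h2
    · rfl
    · norm_num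
    · omega
    · rfl

namespace twoLevel

variable {n K : ℕ}

theorem mean_eq (i : Fin n) : (twoLevel n K).mean i = if K ≤ (i : ℕ) then 1 / 4 else 3 / 4 :=
  integral_id_twoLevelLaw K i

theorem theta_of_le (hn : n = 2 * K) {k : ℕ} (h1 : 1 ≤ k) (hk : k ≤ K) :
    (twoLevel n K).theta k = 3 / 4 := by
  rw [BanditInstance.theta, dif_pos ⟨h1, by omega⟩, mean_eq, if_neg]
  simp only
  omega

theorem theta_of_gt {k : ℕ} (h1 : K < k) (hk : k ≤ n) :
    (twoLevel n K).theta k = 1 / 4 := by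
  rw [BanditInstance.theta, dif_pos ⟨by omega, by omega⟩, mean_eq, if_pos]
  simp only
  omega

theorem gap_eq (hn : n = 2 * K) (hK : 1 ≤ K) {k : ℕ} (h1 : 1 ≤ k) (hk : k ≤ n) :
    (twoLevel n K).gap K k = 1 / 2 := by
  have e1 := theta_of_le hn hK le_rfl
  have e2 : (twoLevel n K).theta (K + 1) = 1 / 4 := theta_of_gt (by omega) (by omega)
  rw [BanditInstance.gap]
  split_ifs with h
  · rw [theta_of_le hn h1 h, e2]; norm_num
  · rw [theta_of_gt (by omega) hk, e1]; norm_num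

theorem hardness_eq (hn : n = 2 * K) (hK : 1 ≤ K) {ε : ℝ} (hε : ε ≤ 1 / 10 ^ 4) :
    (twoLevel n K).hardness K ε = 4 * n := by
  -- The value of `t` is irrelevant; this bound only keeps the indices `K - t` and `K + t + 1`
  -- within `1, …, n`.
  have ht : (twoLevel n K).tol K ε ≤ K - 1 := Nat.findGreatest_le _
  have hP : (twoLevel n K).PsiEps K ((twoLevel n K).tol K ε) ε = 1 / 2 := by
    rw [BanditInstance.PsiEps, BanditInstance.Psi, gap_eq hn hK (by omega) (by omega),
      gap_eq hn hK (by omega) (by omega), min_self]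
    exact max_eq_right (hε.trans (by norm_num))
  rw [BanditInstance.hardness, hP]
  rw [Finset.sum_congr rfl (g := fun _ => (4 : ℝ))]
  · simp [mul_comm]
  · intro k hk
    rw [Finset.mem_Icc] at hk
    rw [gap_eq hn hK hk.1 hk.2]
    norm_num

/-- Each bad label costs `1/2`, so the regret is the number of bad labels divided by `2K = n`. -/
theorem isTopK_map_iff (hn : n = 2 * K) (hK : 1 ≤ K) {ε : ℝ} (hε : 0 ≤ ε) (T : Finset (Fin n))
    (σ : Equiv.Perm (Fin n)) :
    (twoLevel n K).IsTopK K ε (T.map σ.toEmbedding) ↔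
      T.card = K ∧ badCount K T σ ≤ ⌊n * ε⌋₊ := by
  rw [BanditInstance.IsTopK, Finset.card_map]
  refine and_congr_right fun hT => ?_
  have e1 : ∑ k ∈ Finset.Icc 1 K, (twoLevel n K).theta k = K * (3 / 4) := by
    rw [Finset.sum_congr rfl (g := fun _ => (3 / 4 : ℝ))]
    · simp
    · intro k hk
      rw [Finset.mem_Icc] at hk
      exact theta_of_le hn hk.1 hk.2
  have e2 : ∑ i ∈ T.map σ.toEmbedding, (twoLevel n K).mean i =
      K * (3 / 4) - badCount K T σ * (1 / 2) := by
    rw [Finset.sum_map]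
    have : ∀ i, (twoLevel n K).mean (σ.toEmbedding i) =
        3 / 4 - if K ≤ (σ i : ℕ) then 1 / 2 else 0 := by
      intro i
      rw [mean_eq, Equiv.coe_toEmbedding]
      split_ifs <;> norm_num
    simp only [this, Finset.sum_sub_distrib, Finset.sum_const, hT, nsmul_eq_mul,
      ← Finset.sum_filter, badCount]
  have hK' : (0 : ℝ) < K := by exact_mod_cast hK
  rw [BanditInstance.regret, e1, e2, Nat.le_floor_iff (by positivity), sub_sub_cancel,
    one_div_mul_eq_div, div_le_iff₀ hK', show (n : ℝ) = 2 * K by rw [hn]; push_cast; rfl]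
  constructor <;> intro h <;> linarith

end twoLevel

/-! ### Likelihood of a transcript under exchanged labels -/

namespace BanditInstance

open BanditAlgorithm

variable {n : ℕ} (I : BanditInstance n)

/-- The law of the table of all rewards under the labelling `σ`. -/
noncomputable def tableLaw (σ : Equiv.Perm (Fin n)) : Measure (Fin n × ℕ → ℝ) :=
  Measure.infinitePi fun p : Fin n × ℕ => I.reward (σ p.1)

theorem tableLaw_cylinder (σ : Equiv.Perm (Fin n)) (h : List (Fin n × ℝ)) :
    I.tableLaw σ (cylinder h) =
      ∏ j, ∏ k ∈ Finset.range h.length, I.reward (σ j) (compatible h (j, k)) := by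
  rw [tableLaw, cylinder_eq_pi, Measure.infinitePi_pi _ fun p _ => measurableSet_compatible h p,
    Finset.prod_product]

theorem prod_compatible_le {r : ℕ}
    (hI : ∀ i j S, I.reward i S ≤ r * I.reward j S) (h : List (Fin n × ℝ)) (i i' j : Fin n) :
    ∏ k ∈ Finset.range h.length, I.reward i (compatible h (j, k)) ≤
      (r : ℝ≥0∞) ^ (rewardsOf h j).length *
        ∏ k ∈ Finset.range h.length, I.reward i' (compatible h (j, k)) := by
  have e : (r : ℝ≥0∞) ^ (rewardsOf h j).length =
      ∏ k ∈ Finset.range h.length, if k < (rewardsOf h j).length then (r : ℝ≥0∞) else 1 := by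
    rw [← Finset.prod_filter, Finset.prod_const]
    congr 1
    conv_lhs => rw [← Finset.card_range (rewardsOf h j).length]
    congr 1
    ext k
    have := length_rewardsOf_le h j
    simp only [Finset.mem_range, Finset.mem_filter]
    omega
  rw [e, ← Finset.prod_mul_distrib]
  refine Finset.prod_le_prod' fun k _ => ?_
  split_ifs with hk
  · exact hI _ _ _
  · rw [compatible_eq_univ (not_lt.1 hk)]
    simp

/-- Only the rows of `g` and `b` change law, and each has at most `N` recorded cells, each costing a
factor `r`; unread cells have mass `1` under every law. -/
theorem tableLaw_cylinder_le_swap {r : ℕ} (hr : 1 ≤ r)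
    (hI : ∀ i j S, I.reward i S ≤ r * I.reward j S) (h : List (Fin n × ℝ)) {N : ℕ}
    (σ : Equiv.Perm (Fin n)) {g b : Fin n} (hg : (rewardsOf h g).length ≤ N)
    (hb : (rewardsOf h b).length ≤ N) :
    I.tableLaw σ (cylinder h) ≤
      ((r ^ N : ℕ) : ℝ≥0∞) ^ 2 * I.tableLaw (σ * Equiv.swap g b) (cylinder h) := by
  have hr' : (1 : ℝ≥0∞) ≤ ((r ^ N : ℕ) : ℝ≥0∞) := by exact_mod_cast Nat.one_le_pow _ _ hr
  rw [tableLaw_cylinder, tableLaw_cylinder]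
  calc _ ≤ ∏ j, ((if j ∈ ({g, b} : Finset (Fin n)) then ((r ^ N : ℕ) : ℝ≥0∞) else 1) *
        ∏ k ∈ Finset.range h.length,
          I.reward ((σ * Equiv.swap g b) j) (compatible h (j, k))) := by
        refine Finset.prod_le_prod' fun j _ => ?_
        split_ifs with hj
        · have hl : (rewardsOf h j).length ≤ N := by
            rcases Finset.mem_insert.1 hj with rfl | hj
            · exact hg
            · rwa [Finset.mem_singleton.1 hj]
          refine (I.prod_compatible_le hI h (σ j) ((σ * Equiv.swap g b) j) j).trans ?_
          gcongr
          push_cast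
          exact pow_le_pow_right₀ (by exact_mod_cast hr) hl
        · simp only [Finset.mem_insert, Finset.mem_singleton, not_or] at hj
          rw [Equiv.Perm.mul_apply, Equiv.swap_apply_of_ne_of_ne hj.1 hj.2, one_mul]
    _ = ((r ^ N : ℕ) : ℝ≥0∞) ^ ({g, b} : Finset (Fin n)).card *
        ∏ j, ∏ k ∈ Finset.range h.length,
          I.reward ((σ * Equiv.swap g b) j) (compatible h (j, k)) := by
        rw [Finset.prod_mul_distrib, Finset.prod_ite_mem, Finset.univ_inter, Finset.prod_const]
    _ ≤ _ := by
        gcongr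
        exact Finset.card_le_two

variable (A : BanditAlgorithm.{u} n)

instance (σ : Equiv.Perm (Fin n)) : IsProbabilityMeasure (I.tableLaw σ) := by
  unfold tableLaw
  infer_instance

theorem runLaw_eq (σ : Equiv.Perm (Fin n)) : I.runLaw σ A = A.seedLaw.prod (I.tableLaw σ) := rfl

instance (σ : Equiv.Perm (Fin n)) : IsProbabilityMeasure (I.runLaw σ A) := by
  rw [runLaw_eq]
  infer_instance

theorem runLaw_runsTo (σ : Equiv.Perm (Fin n)) (t : ℕ) (h : List (Fin n × ℝ))
    (T : Finset (Fin n)) :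
    I.runLaw σ A (A.runsTo t h T) = A.seedLaw (A.seedsTo t h T) * I.tableLaw σ (cylinder h) := by
  rw [runLaw_eq, runsTo_eq_prod, Measure.prod_prod]

theorem ae_reward_mem {V : Set ℝ} (h : ∀ i, I.reward i Vᶜ = 0)
    (σ : Equiv.Perm (Fin n)) : ∀ᵐ p ∂(I.runLaw σ A), ∀ q, p.2 q ∈ V := by
  have h1 : ∀ᵐ x ∂(I.tableLaw σ), ∀ q, x q ∈ V := by
    rw [ae_all_iff]
    intro q
    have := (measurePreserving_eval_infinitePi
      (fun p : Fin n × ℕ => I.reward (σ p.1)) q).quasiMeasurePreserving.ae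
      (p := fun y => y ∈ V) (by rw [ae_iff]; exact h _)
    exact this
  exact Measure.quasiMeasurePreserving_snd.ae h1

end BanditInstance

/-! ### Choice of the constants -/

theorem swap_budget {a : ℝ} (ha : 0 < a) {n K : ℕ} {ε c : ℝ} (hn : n = 2 * K) (hK : 1 ≤ K)
    (hε : a / n ≤ ε) (hε' : ε ≤ 1 / 10 ^ 4) (hc : 0 < c) (hc1 : c ≤ 1 / 32) (hc2 : c ≤ a ^ 2 / 512)
    {H l : ℕ} (hl : (l : ℝ) < c * n * Real.log (1 / ε))
    (hH : (⌊8 * c * Real.log (1 / ε)⌋₊ + 1) * H ≤ l) :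
    3 ^ ⌊8 * c * Real.log (1 / ε)⌋₊ * (2 * ⌊n * ε⌋₊ + 1) + 2 * ⌊n * ε⌋₊ + H ≤ K := by
  have hKr : (1 : ℝ) ≤ K := by exact_mod_cast hK
  have hnr : (n : ℝ) = 2 * K := by rw [hn]; push_cast; ring
  have hε0 : 0 < ε := lt_of_lt_of_le (by rw [hnr]; positivity) hε
  set L := Real.log (1 / ε) with hL
  set x := 8 * c * L with hx
  set N := ⌊x⌋₊ with hN
  set m := ⌊n * ε⌋₊ with hm
  have hexpL : Real.exp L = 1 / ε := Real.exp_log (by positivity)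
  have hεinv : (10 : ℝ) ^ 4 ≤ 1 / ε := by
    rw [le_div_iff₀ hε0]
    linarith
  have hL0 : 0 ≤ L := Real.log_nonneg (by linarith)
  have hx0 : 0 ≤ x := by positivity
  have hmr : (m : ℝ) ≤ 2 * K * ε := by rw [← hnr]; exact Nat.floor_le (by positivity)
  have hxN : x < N + 1 := Nat.lt_floor_add_one x
  have hHr : (H : ℝ) < K / 4 := by
    have h1 : ((N : ℝ) + 1) * H ≤ l := by exact_mod_cast hH
    -- The factor `8` in `x` is chosen so that the pull budget is `K/4` times `x < N + 1`.
    have h2 : c * n * L = K / 4 * x := by rw [hnr, hx]; ring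
    have h3 : K / 4 * x ≤ K / 4 * ((N : ℝ) + 1) := by gcongr
    have h4 : ((N : ℝ) + 1) * H < ((N : ℝ) + 1) * (K / 4) := by linarith
    exact lt_of_mul_lt_mul_left h4 (by positivity)
  have hKε : (K : ℝ) * ε ≤ K * (1 / 10 ^ 4) := by gcongr
  rcases Nat.eq_zero_or_pos N with h0 | hpos
  · rw [h0]
    have : (4 * m + H : ℝ) < K := by linarith
    have : 4 * m + H < K := by exact_mod_cast this
    omega
  · have hx1 : 1 ≤ x := by
      have h1 : (N : ℝ) ≤ x := Nat.floor_le hx0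
      have h2 : (1 : ℝ) ≤ N := by exact_mod_cast hpos
      linarith
    -- `E = ε^(-1/2)` bounds `3 ^ N`, since `c ≤ 1/32` gives `N log 3 ≤ 2x ≤ L/2`.
    set E := Real.exp (L / 2) with hE
    have hE0 : 0 < E := Real.exp_pos _
    have hE2 : E ^ 2 = 1 / ε := by
      rw [hE, ← Real.exp_nat_mul, ← hexpL]
      congr 1
      push_cast
      ring
    have hpow : (3 : ℝ) ^ N ≤ E := by
      have h1 : (N : ℝ) ≤ x := Nat.floor_le hx0
      have h2 : x ≤ L / 4 := by
        have : c * L ≤ 1 / 32 * L := by gcongr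
        linarith
      have h3 : Real.log 3 ≤ 2 := by
        have := Real.log_le_sub_one_of_pos (show (0 : ℝ) < 3 by norm_num)
        linarith
      have h4 : (3 : ℝ) ^ N = Real.exp (N * Real.log 3) := by
        rw [Real.exp_nat_mul, Real.exp_log (by norm_num)]
      rw [h4, hE, Real.exp_le_exp]
      have h5 : (N : ℝ) * Real.log 3 ≤ N * 2 := by gcongr
      linarith
    have hE100 : 100 ≤ E := by
      refine le_of_sq_le_sq ?_ hE0.le
      rw [hE2]
      linarith
    -- Here `N ≥ 1` enters: `1 ≤ 8cL` and `c ≤ a²/512` force `L ≥ (8/a)²`, while `E² = exp L ≥ L`.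
    have hEa : 8 / a ≤ E := by
      refine le_of_sq_le_sq ?_ hE0.le
      rw [hE2, ← hexpL]
      have h1 : 1 ≤ 8 * (a ^ 2 / 512) * L := by
        refine hx1.trans ?_
        rw [hx]
        gcongr
      have h2 : (8 / a) ^ 2 ≤ L := by
        rw [div_pow, div_le_iff₀ (by positivity)]
        linarith
      have h3 := Real.add_one_le_exp L
      linarith
    have hεE : ε * E ^ 2 = 1 := by rw [hE2]; field_simp
    have hEm : E * (2 * (2 * K * ε)) ≤ K / 25 := by
      have h1 : ε * E ≤ 1 / 100 := by
        have : ε * E * 100 ≤ ε * E * E := by gcongr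
        nlinarith
      have h2 : K * (ε * E) ≤ K * (1 / 100) := by gcongr
      linarith
    -- The only use of `a / n ≤ ε` beyond positivity: `8E ≤ aE² ≤ 2KεE² = 2K`.
    have hEK : E ≤ K / 4 := by
      have h1 : a ≤ 2 * K * ε := by
        rw [div_le_iff₀ (by rw [hnr]; positivity), hnr] at hε
        linarith
      have h2 : 8 ≤ E * a := by rwa [div_le_iff₀ ha] at hEa
      have h3 : E * 8 ≤ E * (E * a) := by gcongr
      have h4 : E * (E * a) ≤ E * (E * (2 * K * ε)) := by gcongr
      have h5 : E * (E * (2 * K * ε)) = 2 * K * (ε * E ^ 2) := by ring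
      rw [h5, hεE] at h4
      linarith
    have hfin : (3 : ℝ) ^ N * (2 * m + 1) + 2 * m + H ≤ K := by
      have h1 : (3 : ℝ) ^ N * (2 * m + 1) ≤ E * (2 * (2 * K * ε) + 1) := by gcongr
      have h2 : E * (2 * (2 * K * ε) + 1) = E * (2 * (2 * K * ε)) + E := by ring
      linarith
    exact_mod_cast hfin

/-! ### Heavy labels and the countable family of binary transcripts -/

namespace BanditAlgorithm

variable {n : ℕ}

/-- The labels pulled more than `N` times in the transcript `h`. -/
def heavy (h : List (Fin n × ℝ)) (N : ℕ) : Finset (Fin n) :=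
  Finset.univ.filter fun j => N < (rewardsOf h j).length

theorem mul_card_heavy_le (h : List (Fin n × ℝ)) (N : ℕ) :
    (N + 1) * (heavy h N).card ≤ h.length := by
  rw [← sum_length_rewardsOf, mul_comm, ← smul_eq_mul]
  refine (Finset.card_nsmul_le_sum (heavy h N) (fun j => (rewardsOf h j).length) (N + 1)
    fun j hj => (Finset.mem_filter.1 hj).2).trans ?_
  exact Finset.sum_le_sum_of_subset (Finset.subset_univ _)

/-- The transcript with rewards `0` and `1` that is encoded by a list of labels and bits. -/
def ofBits (l : List (Fin n × Bool)) : List (Fin n × ℝ) :=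
  l.map fun q => (q.1, if q.2 then 1 else 0)

theorem ofBits_injective : Function.Injective (ofBits : List (Fin n × Bool) → _) := by
  refine List.map_injective_iff.2 ?_
  rintro ⟨i, b⟩ ⟨j, c⟩ h
  obtain ⟨rfl, h⟩ := Prod.mk.inj h
  cases b <;> cases c <;> simp_all

theorem exists_ofBits_eq {h : List (Fin n × ℝ)} (hh : ∀ q ∈ h, q.2 ∈ ({0, 1} : Set ℝ)) :
    ∃ l, ofBits l = h := by
  induction h with
  | nil => exact ⟨[], rfl⟩
  | cons q h ih =>
    obtain ⟨l, rfl⟩ := ih fun r hr => hh r (List.mem_cons_of_mem _ hr)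
    obtain ⟨i, y⟩ := q
    rcases hh _ List.mem_cons_self with hy | hy
    · exact ⟨(i, false) :: l, by simp_all [ofBits]⟩
    · exact ⟨(i, true) :: l, by simp_all [ofBits]⟩

variable (A : BanditAlgorithm.{u} n)

theorem runsTo_disjoint {t : ℕ} {i i' : List (Fin n × Bool) × Finset (Fin n)} (hi : i ≠ i') :
    Disjoint (A.runsTo t (ofBits i.1) i.2) (A.runsTo t (ofBits i'.1) i'.2) := by
  rw [Set.disjoint_left]
  rintro p ⟨h1, h2⟩ ⟨h3, h4⟩
  refine hi (Prod.ext (ofBits_injective (h1.symm.trans h3)) ?_)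
  rw [← h1] at h2
  rw [← h3] at h4
  exact A.output_unique h2 h4

/-- A run with fewer than `B` pulls and rewards `0`, `1` has stopped after `⌈B⌉₊` rounds. -/
theorem exists_mem_runsTo {B : ℝ} {p : A.Seed × (Fin n × ℕ → ℝ)}
    (hp : ¬ ENNReal.ofReal B ≤ (A.pulls p.1 p.2 : ℝ≥0∞)) (hx : ∀ q, p.2 q ∈ ({0, 1} : Set ℝ)) :
    ∃ i : List (Fin n × Bool) × Finset (Fin n),
      ((ofBits i.1).length : ℝ) < B ∧ p ∈ A.runsTo ⌈B⌉₊ (ofBits i.1) i.2 := by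
  have hlen : ((A.history p.1 p.2 ⌈B⌉₊).length : ℝ) < B := by
    by_contra hB
    refine hp ?_
    have h1 : ENNReal.ofReal B ≤ ((A.history p.1 p.2 ⌈B⌉₊).length : ℝ≥0∞) := by
      rw [← ENNReal.ofReal_natCast]
      exact ENNReal.ofReal_le_ofReal (not_lt.1 hB)
    refine h1.trans ?_
    have h2 := A.length_history_le_pulls (s := p.1) (x := p.2) ⌈B⌉₊
    exact_mod_cast ENat.toENNReal_le.2 h2
  obtain ⟨l, hl⟩ := exists_ofBits_eq (A.snd_mem_of_mem_history hx ⌈B⌉₊ (s := p.1))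
  rcases h : A.act p.1 (A.history p.1 p.2 ⌈B⌉₊) with j | T
  -- A run still active after `⌈B⌉₊` rounds has pulled in every round, hence at least `B` times.
  · rw [A.length_history_of_inl h] at hlen
    exact absurd (Nat.le_ceil B) (not_le.2 hlen)
  · exact ⟨(l, T), by rwa [hl], by simp only [hl]; exact ⟨rfl, h⟩⟩

end BanditAlgorithm

/-! ### Averaging over labellings -/

namespace BanditInstance

open BanditAlgorithm

open Classical in
/-- Averaging over labellings: if every short transcript is at least as likely to lead to failure as
to success, then short runs fail at least half of the time. -/
theorem exists_manyPulls {n K : ℕ} (I : BanditInstance n)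
    (hI : ∀ i, I.reward i ({0, 1} : Set ℝ)ᶜ = 0)
    (A : BanditAlgorithm.{u} n) {ε B : ℝ}
    (hw : ∀ (h : List (Fin n × ℝ)) (T : Finset (Fin n)), (h.length : ℝ) < B →
      ∑ σ with I.IsTopK K ε (T.map (Equiv.toEmbedding σ)), I.tableLaw σ (cylinder h) ≤
        ∑ σ with ¬ I.IsTopK K ε (T.map (Equiv.toEmbedding σ)), I.tableLaw σ (cylinder h))
    (hA : ∀ σ : Equiv.Perm (Fin n), 9 / 10 ≤ I.successProb σ K ε A) :
    ∃ σ : Equiv.Perm (Fin n), 1 / 2 ≤ I.manyPullsProb σ B A := by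
  by_contra! hcon
  -- Rewards are almost surely `0` or `1`, so a countable index set covers almost all short runs.
  let ι := List (Fin n × Bool) × Finset (Fin n)
  let short : ι → Prop := fun i => ((ofBits i.1).length : ℝ) < B
  let good : Equiv.Perm (Fin n) → ι → Prop := fun σ i => I.IsTopK K ε (i.2.map σ.toEmbedding)
  let R : ι → Set (A.Seed × (Fin n × ℕ → ℝ)) := fun i => A.runsTo ⌈B⌉₊ (ofBits i.1) i.2
  let S : Equiv.Perm (Fin n) → ι → Set (A.Seed × (Fin n × ℕ → ℝ)) := fun σ i =>
    if short i ∧ good σ i then R i else ∅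
  let F : Equiv.Perm (Fin n) → ι → Set (A.Seed × (Fin n × ℕ → ℝ)) := fun σ i =>
    if short i ∧ ¬ good σ i then R i else ∅
  have hFm : ∀ σ i, MeasurableSet (F σ i) := by
    intro σ i
    simp only [F]
    split_ifs
    · exact A.measurableSet_runsTo _ _ _
    · exact .empty
  have hFsub : ∀ σ i, F σ i ⊆ R i := by
    intro σ i
    simp only [F]
    split_ifs
    · exact subset_rfl
    · exact Set.empty_subset _
  have hFd : ∀ σ, Pairwise (Function.onFun Disjoint (F σ)) := fun σ i i' hi =>
    (A.runsTo_disjoint hi).mono (hFsub σ i) (hFsub σ i')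
  have hcover : ∀ σ, 1 / 2 < (I.runLaw σ A).real ((⋃ i, S σ i) ∪ ⋃ i, F σ i) := by
    intro σ
    set few : Set (A.Seed × (Fin n × ℕ → ℝ)) :=
      {p | ENNReal.ofReal B ≤ (A.pulls p.1 p.2 : ℝ≥0∞)}ᶜ
    have h1 : (I.runLaw σ A) few ≤ (I.runLaw σ A) ((⋃ i, S σ i) ∪ ⋃ i, F σ i) := by
      refine measure_mono_ae ?_
      filter_upwards [I.ae_reward_mem A hI σ] with p hp hfew
      obtain ⟨i, hi, hpi⟩ := A.exists_mem_runsTo hfew hp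
      by_cases hg : good σ i
      · refine Or.inl (Set.mem_iUnion.2 ⟨i, ?_⟩)
        simp only [S]
        rwa [if_pos ⟨hi, hg⟩]
      · refine Or.inr (Set.mem_iUnion.2 ⟨i, ?_⟩)
        simp only [F]
        rwa [if_pos ⟨hi, hg⟩]
    have h2 : (I.runLaw σ A).real few ≤ (I.runLaw σ A).real ((⋃ i, S σ i) ∪ ⋃ i, F σ i) :=
      ENNReal.toReal_mono (measure_ne_top _ _) h1
    have h3 := measureReal_union_le (μ := I.runLaw σ A)
      {p | ENNReal.ofReal B ≤ (A.pulls p.1 p.2 : ℝ≥0∞)} few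
    rw [Set.union_compl_self, probReal_univ] at h3
    have h4 := hcon σ
    rw [manyPullsProb] at h4
    linarith
  have hfail : ∀ σ, (I.runLaw σ A).real (⋃ i, F σ i) ≤ 1 / 10 := by
    intro σ
    have hd : Disjoint
        {p : A.Seed × (Fin n × ℕ → ℝ) | ∃ T, A.Outputs p.1 p.2 T ∧
          I.IsTopK K ε (T.map σ.toEmbedding)} (⋃ i, F σ i) := by
      rw [Set.disjoint_left]
      rintro p ⟨T, ⟨t, ht⟩, hT⟩ hp
      obtain ⟨i, hi⟩ := Set.mem_iUnion.1 hp
      simp only [F] at hi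
      split_ifs at hi with hc
      · obtain ⟨h1, h2⟩ := hi
        rw [← h1] at h2
        rw [A.output_unique ht h2] at hT
        exact hc.2 hT
      · exact hi
    -- Additivity needs only the failure event to be measurable, so measurability of the success
    -- event is never required.
    have h1 := measureReal_union (μ := I.runLaw σ A) hd (MeasurableSet.iUnion (hFm σ))
    have h2 := hA σ
    rw [successProb] at h2
    have h3 := measureReal_le_one (μ := I.runLaw σ A)
      (s := {p : A.Seed × (Fin n × ℕ → ℝ) | ∃ T, A.Outputs p.1 p.2 T ∧
          I.IsTopK K ε (T.map σ.toEmbedding)} ∪ ⋃ i, F σ i)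
    linarith
  have hsum : ∑ σ, I.runLaw σ A (⋃ i, S σ i) ≤ ∑ σ, I.runLaw σ A (⋃ i, F σ i) := by
    calc ∑ σ, I.runLaw σ A (⋃ i, S σ i)
        -- Subadditivity suffices for the success pieces; the failure pieces are recombined at the
        -- end by disjointness.
        ≤ ∑ σ, ∑' i, I.runLaw σ A (S σ i) := Finset.sum_le_sum fun σ _ => measure_iUnion_le _
      _ = ∑' i, ∑ σ, I.runLaw σ A (S σ i) :=
          (Summable.tsum_finsetSum fun _ _ => ENNReal.summable).symm
      _ ≤ ∑' i, ∑ σ, I.runLaw σ A (F σ i) := by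
          refine ENNReal.tsum_le_tsum fun i => ?_
          by_cases hi : short i
          · have e : ∀ (P : Equiv.Perm (Fin n) → Prop) [DecidablePred P],
                ∑ σ, I.runLaw σ A (if short i ∧ P σ then R i else ∅) =
                  A.seedLaw (A.seedsTo ⌈B⌉₊ (ofBits i.1) i.2) *
                    ∑ σ with P σ, I.tableLaw σ (cylinder (ofBits i.1)) := by
              intro P _
              rw [Finset.sum_filter, Finset.mul_sum]
              refine Finset.sum_congr rfl fun σ _ => ?_
              by_cases hP : P σ
              · rw [if_pos ⟨hi, hP⟩, if_pos hP, runLaw_runsTo]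
              · rw [if_neg fun h => hP h.2, if_neg hP, measure_empty, mul_zero]
            simp only [S, F]
            rw [e fun σ => good σ i, e fun σ => ¬ good σ i]
            exact mul_le_mul_right (hw _ i.2 hi) _
          · simp [S, hi]
      _ = ∑ σ, ∑' i, I.runLaw σ A (F σ i) :=
          Summable.tsum_finsetSum fun _ _ => ENNReal.summable
      _ = ∑ σ, I.runLaw σ A (⋃ i, F σ i) := by
          refine Finset.sum_congr rfl fun σ _ => ?_
          rw [measure_iUnion (hFd σ) (hFm σ)]
  have hsum' : ∑ σ, (I.runLaw σ A).real (⋃ i, S σ i) ≤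
      ∑ σ, (I.runLaw σ A).real (⋃ i, F σ i) := by
    simp only [Measure.real]
    rw [← ENNReal.toReal_sum fun _ _ => measure_ne_top _ _,
      ← ENNReal.toReal_sum fun _ _ => measure_ne_top _ _]
    exact ENNReal.toReal_mono (ENNReal.sum_ne_top.2 fun _ _ => measure_ne_top _ _) hsum
  have h1 : ∑ _σ : Equiv.Perm (Fin n), (1 / 2 : ℝ) <
      ∑ σ, ((I.runLaw σ A).real (⋃ i, S σ i) + (I.runLaw σ A).real (⋃ i, F σ i)) :=
    Finset.sum_lt_sum_of_nonempty Finset.univ_nonempty fun σ _ =>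
      (hcover σ).trans_le (measureReal_union_le _ _)
  have h2 : ∑ σ, (I.runLaw σ A).real (⋃ i, F σ i) ≤
      ∑ _σ : Equiv.Perm (Fin n), (1 / 10 : ℝ) := Finset.sum_le_sum fun σ _ => hfail σ
  rw [Finset.sum_add_distrib] at h1
  simp only [Finset.sum_const, nsmul_eq_mul] at h1 h2
  have h3 : (0 : ℝ) ≤ (Finset.univ : Finset (Equiv.Perm (Fin n))).card := Nat.cast_nonneg _
  linarith

end BanditInstance

theorem theorem5 :
    ∃ c₁ > (0 : ℝ), ∃ c₂ > (0 : ℝ), ∀ a > (0 : ℝ), ∃ c > (0 : ℝ),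
      ∀ (n K : ℕ) (ε : ℝ), 1 ≤ K → n = 2 * K → a / n ≤ ε → ε ≤ 1 / 10 ^ 4 →
        ∃ I : BanditInstance n,
          c₁ * n ≤ I.hardness K ε ∧ I.hardness K ε ≤ c₂ * n ∧
          ∀ A : BanditAlgorithm.{u} n,
            (∀ σ : Equiv.Perm (Fin n), 9 / 10 ≤ I.successProb σ K ε A) →
            ∃ σ : Equiv.Perm (Fin n),
              1 / 2 ≤ I.manyPullsProb σ (c * n * Real.log (1 / ε)) A := by
  refine ⟨4, by norm_num, 4, by norm_num, fun a ha => ?_⟩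
  refine ⟨min (1 / 32) (a ^ 2 / 512), lt_min (by norm_num) (by positivity), ?_⟩
  intro n K ε hK hn hε hε'
  set c := min (1 / 32) (a ^ 2 / 512) with hc
  have hc0 : 0 < c := lt_min (by norm_num) (by positivity)
  have hε0 : 0 ≤ ε := le_trans (by positivity) hε
  have hard := twoLevel.hardness_eq hn hK hε'
  refine ⟨twoLevel n K, hard.ge, hard.le, fun A hA => ?_⟩
  refine BanditInstance.exists_manyPulls _ (fun i => twoLevelLaw_compl_zero_one K i) A ?_ hA
  intro h T hlen
  simp only [twoLevel.isTopK_map_iff hn hK hε0]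
  by_cases hT : T.card = K
  · simp only [hT, true_and]
    refine sum_success_le_sum_failure hn hT (H := BanditAlgorithm.heavy h _)
      (q := 3 ^ ⌊8 * c * Real.log (1 / ε)⌋₊) ?_
      (swap_budget ha hn hK hε hε' hc0 (min_le_left _ _) (min_le_right _ _) hlen
        (BanditAlgorithm.mul_card_heavy_le h _)) (by positivity)
    intro σ g hg b hb
    simp only [BanditAlgorithm.heavy, Finset.mem_filter, Finset.mem_univ, true_and, not_lt]
      at hg hb
    refine BanditInstance.tableLaw_cylinder_le_swap _ (by norm_num) (fun i j S => ?_) h σ hg hb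
    exact_mod_cast twoLevelLaw_apply_le K i j S
  -- An output of the wrong size never succeeds, so the left sum is empty.
  · simp [hT]
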